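/- Let $V$ be a finite, totally ordered set of agents and let $G=(V,E)$ be a directed graph on $V$ (an edge $(i,k)\in E$ means that $k$ measures $i$). Assume that $G$ is a dual-entry path (DEP): $V$ consists of two distinct entry agents $i_h, j_h$ and of $\ell\ge 1$ further distinct inner agents $q_1,\dots,q_\ell$, and $$E=\{(i_h,q_1),(j_h,q_\ell)\}\cup\{(q_a,q_{a+1}),(q_{a+1},q_a): 1\le a<\ell\}.$$ Let $\theta\in\mathbb{R}$ and let nominal states $\tilde g_v=[\tilde p_v^\top,\tilde\phi_v]^\top\in\mathbb{R}^3$, with $\tilde p_v\in\mathbb{R}^2$ and $\tilde\phi_v\in\mathbb{R}$, be given for $v\in V$. Put $$\varTheta=\begin{bmatrix}\cos\theta&-\sin\theta&0\\ \sin\theta&\cos\theta&0\\0&0&1\end{bmatrix},\qquad [\tilde p^x_{v,\theta},\tilde p^y_{v,\theta},\tilde\phi_v]^\top=\varTheta^\top\tilde g_v,$$ $\tilde p^x_{uv,\theta}=\tilde p^x_{u,\theta}-\tilde p^x_{v,\theta}$, $\tilde p^y_{uv,\theta}=\tilde p^y_{u,\theta}-\tilde p^y_{v,\theta}$, $\tilde\phi_{uv}=\tilde\phi_u-\tilde\phi_v$,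 and $w_{uv}=\operatorname{diag}(\tilde p^x_{uv,\theta},\tilde p^y_{uv,\theta},\tilde\phi_{uv})$. Let $C=\{(i,j,k)\in V^3:(i,k),(j,k)\in E,\ i<j\}$, and let $\hat M$ be the real matrix with $3\times3$ blocks ($k,i\in V$) $$\hat M_{ki}=\sum_{j:(i,j,k)\in C}w_{jk}+\sum_{j':(j',i,k)\in C}w_{kj'}\quad(k\ne i),\qquad \hat M_{kk}=\sum_{(i,j):(i,j,k)\in C}w_{ij},$$ so that $M=\hat M\,(I\otimes\varTheta^\top)$ is the matrix-valued Laplacian built from the weights $W_{uv}=w_{uv}\varTheta^\top$. Let $\hat M_{ff}$ be the submatrix of $\hat M$ whose block rows and block columns belong to the inner agents (the followers; the entry agents are the leaders). Consider the conditions $$\text{(N)}\quad \prod_{\{u,v\}\in E_u}\tilde p^x_{uv,\theta}\,\tilde p^y_{uv,\theta}\,\tilde\phi_{uv}\ne0,\qquad E_u=\{\{u,v\}:(u,v),(v,u)\in E\}\cup\{\{i_h,j_h\}\},$$ $$\text{(S)}\quad \prod_{a=2}^{\ell}\tilde p^x_{i_hq_a,\theta}\,\tilde p^y_{i_hq_a,\theta}\,\tilde\phi_{i_hq_a}\ne0$$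 (in (N) each unordered pair is taken once, in either order; an empty product is $1$). Then: 1. $\hat M_{ff}$ is nonsingular if and only if (N) holds. 2. If (N) and (S) hold, then there is a real diagonal matrix $D$ such that every (complex) eigenvalue of $D\hat M_{ff}$ has positive real part. -/

import Mathlib

open scoped Matrix

/-- A sensing graph on the agent set `V`: a set of directed edges without loops.
`(i, k) ∈ G.edges` means that agent `k` measures agent `i`. -/
structure SensingGraph (V : Type*) where
  edges : Finset (V × V)
  loopless : ∀ i : V, (i, i) ∉ edges

/-- A nominal formation `(G, g̃, θ)`: a sensing graph, the nominal states
`g̃ v = (p̃ˣ, p̃ʸ, φ̃)` of the agents, and the nominal scaling direction. -/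
structure NominalFormation (V : Type*) where
  graph : SensingGraph V
  state : V → Fin 3 → ℝ
  dir : ℝ

/-- `G` is a dual-entry path with vertex set `V`, entry agents `i, j` and inner agents
`q 0, …, q (ℓ - 1)` in path order: the edges are one edge from `i` to the first inner agent,
one edge from `j` to the last one, and both edges between consecutive inner agents.
(For `ℓ = 1` these are just the two edges from `i` and from `j` to the only inner agent.) -/
structure SensingGraph.IsDEP {V : Type*} (G : SensingGraph V) (i j : V) {ℓ : ℕ}
    (q : Fin ℓ → V) : Prop where
  one_le : 1 ≤ ℓ
  entry_ne : i ≠ j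
  inner_injective : Function.Injective q
  inner_ne_left : ∀ a, q a ≠ i
  inner_ne_right : ∀ a, q a ≠ j
  vertices : ∀ v, v = i ∨ v = j ∨ ∃ a, v = q a
  mem_edges : ∀ u v, (u, v) ∈ G.edges ↔
    (∃ a : Fin ℓ, a.val = 0 ∧ u = i ∧ v = q a) ∨
    (∃ a : Fin ℓ, a.val + 1 = ℓ ∧ u = j ∧ v = q a) ∨
    (∃ a b : Fin ℓ, a.val + 1 = b.val ∧ ((u = q a ∧ v = q b) ∨ (u = q b ∧ v = q a)))

noncomputable section

namespace NominalFormation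

/-- The matrix `Θ`, with diagonal blocks the rotation `R(θ)` and `1`. -/
def rotation (θ : ℝ) : Matrix (Fin 3) (Fin 3) ℝ :=
  !![Real.cos θ, -Real.sin θ, 0;
     Real.sin θ, Real.cos θ, 0;
     0, 0, 1]

variable {V : Type*} (F : NominalFormation V)

/-- The projected nominal state `Θᵀ g̃ᵤ = (p̃ˣ_{u,θ}, p̃ʸ_{u,θ}, φ̃ᵤ)`. -/
def projState (u : V) : Fin 3 → ℝ :=
  (rotation F.dir)ᵀ *ᵥ F.state u

/-- The vector of differences `(p̃ˣ_{uv,θ}, p̃ʸ_{uv,θ}, φ̃_{uv})`. -/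
def diff (u v : V) : Fin 3 → ℝ :=
  F.projState u - F.projState v

/-- The diagonal weight `w_{uv}`. -/
def smallWeight (u v : V) : Matrix (Fin 3) (Fin 3) ℝ :=
  Matrix.diagonal (F.diff u v)

/-- The weight `W_{uv} = w_{uv} Θᵀ`. -/
def weight (u v : V) : Matrix (Fin 3) (Fin 3) ℝ :=
  F.smallWeight u v * (rotation F.dir)ᵀ

/-- The constraint index set: triples `(i, j, k)` with `(i, k), (j, k) ∈ E` and `i < j`. -/
def constraints [Fintype V] [LinearOrder V] : Finset (V × V × V) :=
  Finset.univ.filter fun c =>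
    (c.1, c.2.2) ∈ F.graph.edges ∧ (c.2.1, c.2.2) ∈ F.graph.edges ∧ c.1 < c.2.1

/-- The `3 × 3` block in row `k` and column `i` of the matrix which collects, in block row `k`,
the expressions `U_{jk} (g_i - g_k) + U_{ki} (g_j - g_k)` over all constraints `(i, j, k)`,
for an additive family of weights (`U_{ij} + U_{jk} + U_{ki} = 0`, `U_{ij} = - U_{ji}`);
the coefficient of `g_k` is then `- (U_{jk} + U_{ki}) = U_{ij}`. -/
def block [Fintype V] [LinearOrder V] (U : V → V → Matrix (Fin 3) (Fin 3) ℝ) (k i : V) :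
    Matrix (Fin 3) (Fin 3) ℝ :=
  if k = i then
    ∑ c ∈ F.constraints.filter (fun c => c.2.2 = k), U c.1 c.2.1
  else
    ∑ j ∈ Finset.univ.filter (fun j => (i, j, k) ∈ F.constraints), U j k +
    ∑ j' ∈ Finset.univ.filter (fun j' => (j', i, k) ∈ F.constraints), U k j'

/-- The matrix-valued Laplacian `M`. -/
def laplacian [Fintype V] [LinearOrder V] : Matrix (V × Fin 3) (V × Fin 3) ℝ :=
  Matrix.of fun r s => F.block F.weight r.1 s.1 r.2 s.2

/-- The matrix `M̂`, with `M = M̂ diag(Θᵀ)` (see `laplacian_eq`). -/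
def laplacianHat [Fintype V] [LinearOrder V] : Matrix (V × Fin 3) (V × Fin 3) ℝ :=
  Matrix.of fun r s => F.block F.smallWeight r.1 s.1 r.2 s.2

theorem laplacian_eq [Fintype V] [LinearOrder V] :
    F.laplacian =
      F.laplacianHat * Matrix.kronecker (1 : Matrix V V ℝ) (rotation F.dir)ᵀ := by
  have hb : ∀ k i, F.block F.weight k i = F.block F.smallWeight k i * (rotation F.dir)ᵀ := by
    intro k i
    unfold block
    split_ifs
    · simp only [weight, Finset.sum_mul]
    · simp only [weight, Finset.sum_mul, add_mul]
  ext ⟨k, a⟩ ⟨i, b⟩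
  simp [laplacian, laplacianHat, hb, Matrix.mul_apply, Fintype.sum_prod_type, Matrix.one_apply]

/-- The follower block `M̂_ff` of `M̂`, for the leader set `L`. -/
def followerBlock [Fintype V] [LinearOrder V] (L : Finset V) :
    Matrix ({v : V // v ∉ L} × Fin 3) ({v : V // v ∉ L} × Fin 3) ℝ :=
  F.laplacianHat.submatrix (fun r => (r.1.1, r.2)) (fun r => (r.1.1, r.2))

/-- The pairs of `E_u`: the bidirectional edges and the pair of entry agents. Each unordered
pair `{u, v}` is represented once, by `(u, v)` with `u < v`. -/
def nondegeneracyPairs [Fintype V] [LinearOrder V] (i j : V) : Finset (V × V) :=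
  Finset.univ.filter fun e => e.1 < e.2 ∧
    (((e.1, e.2) ∈ F.graph.edges ∧ (e.2, e.1) ∈ F.graph.edges) ∨ s(e.1, e.2) = s(i, j))

/-- The nondegeneracy condition for the entry agents `i, j`. -/
def Nondegenerate [Fintype V] [LinearOrder V] (i j : V) : Prop :=
  ∏ e ∈ F.nondegeneracyPairs i j,
    (F.diff e.1 e.2 0 * F.diff e.1 e.2 1 * F.diff e.1 e.2 2) ≠ 0

/-- The stability condition; the product runs over all inner agents but the first one. -/
def StabilityCondition (i : V) {ℓ : ℕ} (q : Fin ℓ → V) : Prop :=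
  ∏ l ∈ Finset.univ.filter (fun l : Fin ℓ => 1 ≤ l.val),
    (F.diff i (q l) 0 * F.diff i (q l) 1 * F.diff i (q l) 2) ≠ 0

end NominalFormation

end

/-! An inner agent has exactly two in-neighbours, its neighbours on the path, so it carries one
constraint. The weights are diagonal, so up to row signs and reindexing the follower block is a
direct sum of three tridiagonal matrices `pathMatrix ℓ x`, one per projected coordinate, where `x`
lists that coordinate along the path (`exists_followerBlock_eq`).

Extend a vector by `Y 0 = Y (ℓ + 1) = 0`. It lies in the kernel of `pathMatrix ℓ x` iff, across each
inner vertex, the two increments of `Y` are parallel to those of `x`. If the inner increments of `x`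
are nonzero, all increments are parallel, and summing along the path forces `Y = 0` unless the ends
of `x` agree. Conversely, equal ends put `x - x 0` in the kernel, and a vanishing inner increment
makes two rows dependent (`pathMatrix_det_ne_zero_iff`).

For stability, (N) and (S) together make the pivots nonzero, giving an `LU` factorization
(`pathMatrix_eq_mul`). Then `D L U` is similar to `U D L`; a diagonal `D` with rapidly separated
scales makes a conjugate of the latter strictly diagonally dominant with positive diagonal, and
Gershgorin's theorem applies (`Matrix.exists_isDiag_forall_eigenvalue_re_pos`). -/

/-! ### Diagonal stabilization of matrices with an `LU` factorization. -/

/-- A triangular matrix with nonzero diagonal, with respect to a rank function on its index type,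
has trivial kernel. -/
theorem Matrix.mulVec_ne_zero_of_rank_triangular {ι K : Type*} [Fintype ι] [Field K]
    (r : ι → ℕ) (U : Matrix ι ι K) (hU : ∀ i k, U i k ≠ 0 → i = k ∨ r i < r k)
    (hd : ∀ i, U i i ≠ 0) {y : ι → K} (hy : y ≠ 0) : U *ᵥ y ≠ 0 := by
  classical
  obtain ⟨i₀, hi₀⟩ := Function.ne_iff.mp hy
  obtain ⟨i, hi, hmax⟩ := Finset.exists_max_image (Finset.univ.filter fun i => y i ≠ 0) r
    ⟨i₀, by simpa using hi₀⟩
  have hyi : y i ≠ 0 := by simpa using hi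
  intro h
  have h1 : (U *ᵥ y) i = U i i * y i := by
    refine Finset.sum_eq_single i (fun k _ hk => ?_) (by simp)
    by_cases hyk : y k = 0
    · simp [hyk]
    · have hle := hmax k (by simpa using hyk)
      have : U i k = 0 := by
        by_contra hne
        rcases hU i k hne with rfl | hlt
        · exact hk rfl
        · omega
      simp [this]
  rw [h] at h1
  exact mul_ne_zero (hd i) hyi h1.symm

/-- The conjugate of `U D L` by `diagonal (ε ^ r)`, with row `i` divided by `ε ^ (2 * r i)`, where
`D = diagonal (s * ε ^ (2 * r))`. -/
noncomputable def Matrix.scaledConj {ι : Type*} [Fintype ι] (r : ι → ℕ) (L U : Matrix ι ι ℝ)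
    (s : ι → ℝ) (ε : ℝ) : Matrix ι ι ℝ :=
  Matrix.of fun i j => ∑ k, U i k * s k * L k j * ε ^ (2 * r k - r i - r j)

/-- In a nonzero term `r i` and `r j` are at most `r k`, so the truncated exponent is exact; it
vanishes only for `i = k = j`. -/
theorem Matrix.scaledConj_zero {ι : Type*} [Fintype ι] [DecidableEq ι] (r : ι → ℕ)
    (L U : Matrix ι ι ℝ) (s : ι → ℝ)
    (hL : ∀ k j, L k j ≠ 0 → k = j ∨ r j < r k)
    (hU : ∀ i k, U i k ≠ 0 → i = k ∨ r i < r k) :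
    Matrix.scaledConj r L U s 0 = Matrix.diagonal fun i => U i i * s i * L i i := by
  ext i j
  rw [Matrix.scaledConj, Matrix.of_apply, Matrix.diagonal_apply]
  have hterm : ∀ k, U i k * s k * L k j * (0 : ℝ) ^ (2 * r k - r i - r j) =
      if k = i ∧ i = j then U i i * s i * L i i else 0 := by
    intro k
    by_cases hu : U i k = 0
    · rw [hu]
      split_ifs with h
      · obtain ⟨rfl, rfl⟩ := h
        simp [hu]
      · simp
    by_cases hl : L k j = 0
    · rw [hl]
      split_ifs with h
      · obtain ⟨rfl, rfl⟩ := h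
        simp [hl]
      · simp
    rcases hU i k hu with rfl | h1
    · rcases hL i j hl with rfl | h2
      · simp [← two_mul]
      · have : i ≠ j := by rintro rfl; omega
        rw [zero_pow (by omega)]
        simp [this]
    · have : k ≠ i := by rintro rfl; omega
      have h2 : r j ≤ r k := by
        rcases hL k j hl with rfl | h2 <;> omega
      rw [zero_pow (by omega)]
      simp [this]
  simp only [hterm]
  by_cases hij : i = j <;> simp [hij]

/-- A real matrix with an `LU` factorization with nonzero pivots can be stabilized by a diagonal
left factor: all eigenvalues of the product have positive real part. -/
theorem Matrix.exists_isDiag_forall_eigenvalue_re_pos {ι : Type*} [Fintype ι] [DecidableEq ι]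
    (r : ι → ℕ) (L U : Matrix ι ι ℝ)
    (hL : ∀ k j, L k j ≠ 0 → k = j ∨ r j < r k)
    (hU : ∀ i k, U i k ≠ 0 → i = k ∨ r i < r k)
    (hLd : ∀ i, L i i ≠ 0) (hUd : ∀ i, U i i ≠ 0) :
    ∃ D : Matrix ι ι ℝ, D.IsDiag ∧ ∀ μ : ℂ,
      Module.End.HasEigenvalue (Matrix.toLin' ((D * (L * U)).map (algebraMap ℝ ℂ))) μ →
        0 < μ.re := by
  -- With this choice the limit diagonal `U i i * s i * L i i` is a square, hence positive.
  set s : ι → ℝ := fun i => U i i * L i i with hs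
  set C := Matrix.scaledConj r L U s with hC
  have hcont : ∀ i j, Continuous fun ε => C ε i j := by
    intro i j
    simp only [hC, Matrix.scaledConj, Matrix.of_apply]
    fun_prop
  have hev : ∀ᶠ ε in nhdsWithin (0 : ℝ) (Set.Ioi 0),
      ∀ i, 0 < C ε i i - ∑ j ∈ Finset.univ.erase i, |C ε i j| := by
    refine Filter.eventually_all.mpr fun i => ?_
    have hc : Continuous fun ε => C ε i i - ∑ j ∈ Finset.univ.erase i, |C ε i j| :=
      (hcont i i).sub (continuous_finsetSum _ fun j _ => (hcont i j).abs)
    refine nhdsWithin_le_nhds (hc.continuousAt.eventually (lt_mem_nhds ?_))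
    simp only [hC, Matrix.scaledConj_zero r L U s hL hU]
    rw [Finset.sum_eq_zero, Matrix.diagonal_apply_eq]
    · have := mul_self_pos.mpr (mul_ne_zero (hUd i) (hLd i))
      simp only [hs, sub_zero]
      linarith [this, mul_comm (U i i * L i i) (U i i)]
    · intro j hj
      rw [Matrix.diagonal_apply_ne _ (Finset.ne_of_mem_erase hj).symm, abs_zero]
  obtain ⟨ε, hε, hεpos⟩ := (hev.and self_mem_nhdsWithin).exists
  replace hεpos : 0 < ε := hεpos
  refine ⟨Matrix.diagonal fun i => s i * ε ^ (2 * r i), Matrix.isDiag_diagonal _, fun μ hμ => ?_⟩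
  set D : Matrix ι ι ℝ := Matrix.diagonal fun i => s i * ε ^ (2 * r i) with hD
  set N : Matrix ι ι ℝ := Matrix.of fun i j => ε ^ (2 * r i) * C ε i j with hN
  have hconj : N * Matrix.diagonal (fun i => ε ^ r i) =
      Matrix.diagonal (fun i => ε ^ r i) * (U * D * L) := by
    ext i j
    rw [Matrix.mul_diagonal, Matrix.diagonal_mul, Matrix.mul_apply, hN, Matrix.of_apply, hC,
      Matrix.scaledConj, Matrix.of_apply, Finset.mul_sum, Finset.sum_mul, Finset.mul_sum]
    refine Finset.sum_congr rfl fun k _ => ?_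
    rw [hD, Matrix.mul_diagonal]
    by_cases hu : U i k = 0
    · simp [hu]
    by_cases hl : L k j = 0
    · simp [hl]
    have h1 : r i ≤ r k := by rcases hU i k hu with rfl | h <;> omega
    have h2 : r j ≤ r k := by rcases hL k j hl with rfl | h <;> omega
    have h3 : ε ^ (2 * r i) * ε ^ (2 * r k - r i - r j) * ε ^ r j = ε ^ r i * ε ^ (2 * r k) := by
      rw [← pow_add, ← pow_add, ← pow_add]
      congr 1
      omega
    linear_combination (U i k * s k * L k j) * h3
  obtain ⟨y, hy⟩ := hμ.exists_hasEigenvector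
  have hy0 : y ≠ 0 := hy.2
  have hyμ : (D * (L * U)).map (algebraMap ℝ ℂ) *ᵥ y = μ • y := by
    simpa using hy.apply_eq_smul
  -- `P` intertwines `D L U` with `N`, the rescaled `U D L`, so it carries eigenvectors to
  -- eigenvectors.
  set P : Matrix ι ι ℝ := Matrix.diagonal (fun i => ε ^ r i) * U with hP
  have hPd : ∀ i k, P i k = ε ^ r i * U i k := fun i k => by rw [hP, Matrix.diagonal_mul]
  have hNP : N * P = P * (D * (L * U)) := by
    rw [hP, ← Matrix.mul_assoc, hconj]
    simp only [Matrix.mul_assoc]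
  set w := P.map (algebraMap ℝ ℂ) *ᵥ y with hw
  have hw0 : w ≠ 0 := by
    refine Matrix.mulVec_ne_zero_of_rank_triangular r _ (fun i k h => hU i k ?_) (fun i => ?_) hy0
    · rintro h0
      simp [hPd, h0] at h
    · simp [hPd, hUd i, hεpos.ne']
  have hwμ : N.map (algebraMap ℝ ℂ) *ᵥ w = μ • w := by
    rw [hw, Matrix.mulVec_mulVec, ← Matrix.map_mul, hNP, Matrix.map_mul, ← Matrix.mulVec_mulVec,
      hyμ, Matrix.mulVec_smul]
  have hNμ : Module.End.HasEigenvalue (Matrix.toLin' (N.map (algebraMap ℝ ℂ))) μ :=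
    Module.End.hasEigenvalue_of_hasEigenvector (x := w)
      ⟨Module.End.mem_eigenspace_iff.mpr (by simpa using hwμ), hw0⟩
  -- Gershgorin: the factor `ε ^ (2 * r i)` scales centre and radius of a row alike, so dominance of
  -- `C ε` suffices.
  obtain ⟨i, hi⟩ := eigenvalue_mem_ball hNμ
  rw [mem_closedBall_iff_norm] at hi
  have hsum : ∑ j ∈ Finset.univ.erase i, ‖N.map (algebraMap ℝ ℂ) i j‖ =
      ε ^ (2 * r i) * ∑ j ∈ Finset.univ.erase i, |C ε i j| := by
    rw [Finset.mul_sum]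
    refine Finset.sum_congr rfl fun j _ => ?_
    simp [hN, abs_of_pos hεpos]
  rw [hsum] at hi
  have hre := (abs_le.mp ((Complex.abs_re_le_norm _).trans hi)).1
  have hii : (N.map (algebraMap ℝ ℂ) i i).re = ε ^ (2 * r i) * C ε i i := by
    simp only [Matrix.map_apply, hN, Matrix.of_apply, Complex.coe_algebraMap, Complex.ofReal_re]
  rw [Complex.sub_re, hii] at hre
  have := mul_pos (pow_pos hεpos (2 * r i)) (hε i)
  linarith

/-! ### Nonsingularity of the path matrix. -/

/-- The tridiagonal matrix of the Laplacian of a path with scalar positions `x 0, …, x (n + 1)`,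
restricted to the inner vertices `1, …, n`. -/
def pathMatrix (n : ℕ) (x : ℕ → ℝ) : Matrix (Fin n) (Fin n) ℝ :=
  Matrix.of fun a b =>
    if b.val = a.val then x a - x (a + 2)
    else if b.val + 1 = a.val then x (a + 2) - x (a + 1)
    else if b.val = a.val + 1 then x (a + 1) - x a
    else 0

theorem pathMatrix_mulVec (n : ℕ) (x Y : ℕ → ℝ) (h0 : Y 0 = 0) (hn : Y (n + 1) = 0) (a : Fin n) :
    (pathMatrix n x *ᵥ fun b => Y (b + 1)) a =
      (x (a + 2) - x (a + 1)) * (Y a - Y (a + 1)) + (x (a + 1) - x a) * (Y (a + 2) - Y (a + 1)) := by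
  have hterm : ∀ b : Fin n, pathMatrix n x a b * Y (b + 1) =
      ((if b.val = a.val then (x a - x (a + 2)) * Y (a + 1) else 0) +
      (if b.val + 1 = a.val then (x (a + 2) - x (a + 1)) * Y a else 0)) +
      (if b.val = a.val + 1 then (x (a + 1) - x a) * Y (a + 2) else 0) := by
    intro b
    simp only [pathMatrix, Matrix.of_apply]
    split_ifs with h1 h2 h3 <;> first | omega | simp_all
  change ∑ b, pathMatrix n x a b * Y (b + 1) = _
  simp only [hterm, Finset.sum_add_distrib]
  have e1 : ∑ b : Fin n, (if b.val = a.val then (x a - x (a + 2)) * Y (a + 1) else 0) =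
      (x a - x (a + 2)) * Y (a + 1) := by
    rw [Finset.sum_eq_single a]
    · simp
    · intro b _ hb
      rw [if_neg (fun h => hb (Fin.ext h))]
    · simp
  have e2 : ∑ b : Fin n, (if b.val + 1 = a.val then (x (a + 2) - x (a + 1)) * Y a else 0) =
      (x (a + 2) - x (a + 1)) * Y a := by
    by_cases ha : a.val = 0
    · rw [ha, h0]
      simp
    · rw [Finset.sum_eq_single ⟨a - 1, by omega⟩]
      · rw [if_pos (by simp only; omega)]
      · intro b _ hb
        rw [if_neg]
        intro h
        exact hb (Fin.ext (by simp only; omega))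
      · simp
  have e3 : ∑ b : Fin n, (if b.val = a.val + 1 then (x (a + 1) - x a) * Y (a + 2) else 0) =
      (x (a + 1) - x a) * Y (a + 2) := by
    by_cases ha : a.val + 1 = n
    · have : Y (a + 2) = 0 := by
        rw [← hn]
        congr 1
        omega
      simp [this]
    · rw [Finset.sum_eq_single ⟨a + 1, by omega⟩]
      · simp
      · intro b _ hb
        rw [if_neg]
        intro h
        exact hb (Fin.ext h)
      · simp
  rw [e1, e2, e3]
  ring

theorem pathMatrix_det_ne_zero (n : ℕ) (x : ℕ → ℝ)
    (hx : ∀ k, 1 ≤ k → k < n → x (k + 1) - x k ≠ 0) (hends : x (n + 1) - x 0 ≠ 0) :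
    (pathMatrix n x).det ≠ 0 := by
  intro hdet
  obtain ⟨y, hy0, hy⟩ := Matrix.exists_mulVec_eq_zero_iff.mpr hdet
  -- The kernel vector, shifted to positions `1, …, n` and extended by zero at both ends.
  set Y : ℕ → ℝ := fun m => if h : 1 ≤ m ∧ m ≤ n then y ⟨m - 1, by omega⟩ else 0 with hY
  have hyY : y = fun b : Fin n => Y (b + 1) := by
    ext b
    simp [hY]
  have hY0 : Y 0 = 0 := by simp [hY]
  have hYn : Y (n + 1) = 0 := by simp [hY]
  have hrec : ∀ m, m < n → (x (m + 2) - x (m + 1)) * (Y (m + 1) - Y m) =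
      (x (m + 1) - x m) * (Y (m + 2) - Y (m + 1)) := by
    intro m hm
    have h := pathMatrix_mulVec n x Y hY0 hYn ⟨m, hm⟩
    rw [← hyY, hy] at h
    simp only [Pi.zero_apply] at h
    linarith
  have hpar : ∀ m, m ≤ n → ∀ k, k ≤ m → (x (m + 1) - x m) * (Y (k + 1) - Y k) =
      (x (k + 1) - x k) * (Y (m + 1) - Y m) := by
    intro m
    induction m with
    | zero =>
      intro _ k hk
      obtain rfl : k = 0 := by omega
      rfl
    | succ m ih =>
      intro hm k hk
      rcases Nat.lt_or_ge m k with h | h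
      · obtain rfl : k = m + 1 := by omega
        rfl
      · have hr := hrec m (by omega)
        rcases Nat.eq_zero_or_pos m with rfl | hpos
        · obtain rfl : k = 0 := by omega
          exact hr
        -- Only an inner increment is cancelled; the two end increments of `x` may vanish.
        · refine mul_left_cancel₀ (hx m hpos (by omega)) ?_
          linear_combination (x (m + 2) - x (m + 1)) * ih (by omega) k h + (x (k + 1) - x k) * hr
  have hpar' : ∀ m, m ≤ n → ∀ k, k ≤ n → (x (m + 1) - x m) * (Y (k + 1) - Y k) =
      (x (k + 1) - x k) * (Y (m + 1) - Y m) := by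
    intro m hm k hk
    rcases le_total k m with h | h
    · exact hpar m hm k h
    · exact (hpar k hk m h).symm
  have hconst : ∀ m, m ≤ n → Y (m + 1) - Y m = 0 := by
    intro m hm
    have hsum : ∑ k ∈ Finset.range (n + 1), (x (m + 1) - x m) * (Y (k + 1) - Y k) =
        ∑ k ∈ Finset.range (n + 1), (x (k + 1) - x k) * (Y (m + 1) - Y m) :=
      Finset.sum_congr rfl fun k hk => hpar' m hm k (by simpa [Nat.lt_succ_iff] using hk)
    rw [← Finset.mul_sum, ← Finset.sum_mul, Finset.sum_range_sub, Finset.sum_range_sub, hY0, hYn,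
      sub_zero, mul_zero] at hsum
    exact (mul_eq_zero.mp hsum.symm).resolve_left hends
  have hzero : ∀ m, m ≤ n → Y m = 0 := by
    intro m
    induction m with
    | zero => exact fun _ => hY0
    | succ m ih =>
      intro hm
      linarith [hconst m (by omega), ih (by omega)]
  apply hy0
  rw [hyY]
  ext b
  exact hzero _ b.2

theorem pathMatrix_det_eq_zero_of_ends (n : ℕ) (hn : 1 ≤ n) (x : ℕ → ℝ)
    (hends : x (n + 1) - x 0 = 0) : (pathMatrix n x).det = 0 := by
  apply Matrix.exists_mulVec_eq_zero_iff.mp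
  -- The kernel vector `x - x 0` may itself vanish; then `x` is constant and the matrix is zero.
  by_cases hx : ∀ b : Fin n, x (b + 1) - x 0 = 0
  · refine ⟨fun _ => 1, fun h => one_ne_zero (congrFun h ⟨0, hn⟩), ?_⟩
    have hx' : ∀ m, m ≤ n + 1 → x m = x 0 := by
      intro m hm
      rcases Nat.eq_zero_or_pos m with rfl | hpos
      · rfl
      · rcases Nat.lt_or_ge n m with h | h
        · obtain rfl : m = n + 1 := by omega
          linarith
        · have := hx ⟨m - 1, by omega⟩
          simp only [Nat.sub_add_cancel hpos] at this
          linarith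
    have : pathMatrix n x = 0 := by
      ext a b
      simp [pathMatrix, hx' a (by omega), hx' (a + 1) (by omega), hx' (a + 2) (by omega)]
    simp [this]
  · refine ⟨fun b => x (b + 1) - x 0, fun h => hx fun b => congrFun h b, ?_⟩
    ext a
    rw [pathMatrix_mulVec n x (fun m => x m - x 0) (sub_self _) hends, Pi.zero_apply]
    ring

/-- When positions `k` and `k + 1` coincide, the rows of these two vertices are both multiples of
the difference of the same two unit vectors. -/
theorem pathMatrix_det_eq_zero_of_edge (n : ℕ) (x : ℕ → ℝ) (k : ℕ) (hk : 1 ≤ k) (hkn : k < n)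
    (hx : x (k + 1) - x k = 0) : (pathMatrix n x).det = 0 := by
  set a : Fin n := ⟨k - 1, by omega⟩ with ha
  set b : Fin n := ⟨k, hkn⟩ with hb
  have hab : a ≠ b := by
    intro h
    have := congrArg Fin.val h
    simp only [ha, hb] at this
    omega
  obtain ⟨m, rfl⟩ : ∃ m, k = m + 1 := ⟨k - 1, by omega⟩
  have hrow : ∀ c, (x (m + 3) - x (m + 2)) * pathMatrix n x a c +
      (x (m + 1) - x m) * pathMatrix n x b c = 0 := by
    intro c
    have hxx : x (m + 2) = x (m + 1) := by linarith
    simp only [pathMatrix, Matrix.of_apply, ha, hb, Nat.add_sub_cancel]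
    split_ifs <;> first | omega | (simp only [add_assoc, Nat.reduceAdd, hxx]; ring)
  by_cases h : x (m + 1) - x m = 0
  · refine Matrix.det_eq_zero_of_row_eq_zero a fun c => ?_
    have hxx : x (m + 2) = x (m + 1) := by linarith
    have hxy : x (m + 1) = x m := by linarith
    simp [pathMatrix, ha, hxx, hxy]
  · apply Matrix.exists_vecMul_eq_zero_iff.mp
    refine ⟨Pi.single a (x (m + 3) - x (m + 2)) + Pi.single b (x (m + 1) - x m), ?_, ?_⟩
    · intro h0
      have := congrFun h0 b
      simp [hab.symm] at this
      exact h this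
    · ext c
      rw [Matrix.add_vecMul]
      simpa [Matrix.single_vecMul] using hrow c

theorem pathMatrix_det_ne_zero_iff (n : ℕ) (hn : 1 ≤ n) (x : ℕ → ℝ) :
    (pathMatrix n x).det ≠ 0 ↔
      (∀ k, 1 ≤ k → k < n → x (k + 1) - x k ≠ 0) ∧ x (n + 1) - x 0 ≠ 0 :=
  ⟨fun h => ⟨fun k hk hkn h0 => h (pathMatrix_det_eq_zero_of_edge n x k hk hkn h0),
    fun h0 => h (pathMatrix_det_eq_zero_of_ends n hn x h0)⟩,
    fun h => pathMatrix_det_ne_zero n x h.1 h.2⟩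

/-! ### The `LU` factorization of the path matrix. -/

/-- The pivots of `pathMatrix`. -/
noncomputable def pathPivot (x : ℕ → ℝ) (a : ℕ) : ℝ :=
  -- The general formula would divide by `x 1 - x 0`, which may vanish; for `a = 0` that factor is
  -- cancelled beforehand.
  if a = 0 then x 0 - x 2 else -((x (a + 1) - x a) * (x (a + 2) - x 0) / (x (a + 1) - x 0))

/-- The lower triangular factor of `pathMatrix`. -/
noncomputable def pathLower (n : ℕ) (x : ℕ → ℝ) : Matrix (Fin n) (Fin n) ℝ :=
  Matrix.of fun a b =>
    if b = a then 1
    else if b.val + 1 = a.val then (x (a + 2) - x (a + 1)) / pathPivot x b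
    else 0

/-- The upper triangular factor of `pathMatrix`. -/
noncomputable def pathUpper (n : ℕ) (x : ℕ → ℝ) : Matrix (Fin n) (Fin n) ℝ :=
  Matrix.of fun a b =>
    if b.val = a.val then pathPivot x a
    else if b.val = a.val + 1 then x (a + 1) - x a
    else 0

theorem pathPivot_ne_zero (n : ℕ) (x : ℕ → ℝ)
    (hx : ∀ k, 1 ≤ k → k < n → x (k + 1) - x k ≠ 0)
    (hs : ∀ k, 2 ≤ k → k ≤ n + 1 → x k - x 0 ≠ 0) (a : ℕ) (ha : a < n) :
    pathPivot x a ≠ 0 := by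
  unfold pathPivot
  split_ifs with h
  · intro h0
    exact hs 2 le_rfl (by omega) (by linarith)
  · exact neg_ne_zero.mpr (div_ne_zero (mul_ne_zero (hx a (by omega) ha)
      (hs (a + 2) (by omega) (by omega))) (hs (a + 1) (by omega) (by omega)))

/-- The elimination step: this is the diagonal entry of row `a + 1` in the product of the two
factors. -/
theorem pathPivot_succ (n : ℕ) (x : ℕ → ℝ)
    (hx : ∀ k, 1 ≤ k → k < n → x (k + 1) - x k ≠ 0)
    (hs : ∀ k, 2 ≤ k → k ≤ n + 1 → x k - x 0 ≠ 0) (a : ℕ) (ha : a + 1 < n) :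
    (x (a + 3) - x (a + 2)) / pathPivot x a * (x (a + 1) - x a) + pathPivot x (a + 1) =
      x (a + 1) - x (a + 3) := by
  have h2 := hs (a + 2) (by omega) (by omega)
  rcases Nat.eq_zero_or_pos a with rfl | hpos
  · have h2' : x 0 - x 2 ≠ 0 := fun h => h2 (by simp only [zero_add]; linarith)
    simp only [pathPivot, zero_add, Nat.reduceAdd, if_true, one_ne_zero, if_false] at h2 ⊢
    field_simp
    ring
  · have h1 := hs (a + 1) (by omega) (by omega)
    have h3 := hx a hpos (by omega)
    simp only [pathPivot, hpos.ne', if_false, Nat.add_eq_zero_iff, one_ne_zero, and_false,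
      add_assoc, Nat.reduceAdd]
    field_simp
    ring

theorem pathMatrix_eq_mul (n : ℕ) (x : ℕ → ℝ)
    (hx : ∀ k, 1 ≤ k → k < n → x (k + 1) - x k ≠ 0)
    (hs : ∀ k, 2 ≤ k → k ≤ n + 1 → x k - x 0 ≠ 0) :
    pathMatrix n x = pathLower n x * pathUpper n x := by
  ext a b
  rw [Matrix.mul_apply]
  rcases Nat.eq_zero_or_pos a.val with h0 | hpos
  · rw [Finset.sum_eq_single a]
    · simp only [pathMatrix, pathLower, pathUpper, Matrix.of_apply, pathPivot, h0, if_true]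
      split_ifs <;> first | omega | contradiction | simp
    · intro c _ hc
      simp only [pathLower, Matrix.of_apply]
      rw [if_neg hc, if_neg (by omega), zero_mul]
    · simp
  · obtain ⟨m, hm⟩ : ∃ m, a.val = m + 1 := ⟨a - 1, by omega⟩
    have hmn : m < n := by omega
    have hne : (⟨m, hmn⟩ : Fin n) ≠ a := by
      intro h
      have := congrArg Fin.val h
      simp only at this
      omega
    rw [Fintype.sum_eq_add ⟨m, hmn⟩ a hne]
    · have hp := pathPivot_ne_zero n x hx hs m hmn
      have hsucc := pathPivot_succ n x hx hs m (by omega)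
      simp only [pathMatrix, pathLower, pathUpper, Matrix.of_apply, hm, hne, if_true, if_false,
        one_mul, add_assoc, Nat.reduceAdd]
      split_ifs <;> first | omega | simp [hp] | exact hsucc.symm
    · rintro c ⟨hc1, hc2⟩
      have : ¬ c.val + 1 = a.val := fun h => hc1 (Fin.ext (by simp only; omega))
      simp [pathLower, hc2, this]

/-! ### Blocks of an agent with two in-neighbours. -/

namespace NominalFormation

variable {V : Type*} (F : NominalFormation V)

theorem smallWeight_swap (u v : V) : F.smallWeight v u = -F.smallWeight u v := by
  rw [smallWeight, smallWeight, Matrix.diagonal_neg]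
  congr 1
  ext c
  simp [diff]

theorem diff_swap_ne_zero {u v : V} {c : Fin 3} : F.diff v u c ≠ 0 ↔ F.diff u v c ≠ 0 := by
  simp only [diff, Pi.sub_apply, sub_ne_zero]
  exact ne_comm

section Block

variable [Fintype V] [LinearOrder V]

/-- The blocks of a row whose agent has exactly two in-neighbours. -/
theorem block_of_two_neighbours (U : V → V → Matrix (Fin 3) (Fin 3) ℝ) {a b k : V}
    (hE : ∀ u, (u, k) ∈ F.graph.edges ↔ u = a ∨ u = b) (hab : a < b) (hak : a ≠ k) (hbk : b ≠ k)
    (v : V) :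
    F.block U k v =
      if v = k then U a b else if v = a then U b k else if v = b then U k a else 0 := by
  have hC : ∀ u w, (u, w, k) ∈ F.constraints ↔ u = a ∧ w = b := by
    intro u w
    simp only [constraints, Finset.mem_filter, Finset.mem_univ, true_and, hE]
    constructor
    · rintro ⟨rfl | rfl, rfl | rfl, h⟩
      · exact absurd h (lt_irrefl _)
      · exact ⟨rfl, rfl⟩
      · exact absurd h hab.not_gt
      · exact absurd h (lt_irrefl _)
    · rintro ⟨rfl, rfl⟩
      exact ⟨Or.inl rfl, Or.inr rfl, hab⟩
  unfold block
  by_cases hvk : v = k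
  · subst hvk
    have : F.constraints.filter (fun c => c.2.2 = v) = {(a, b, v)} := by
      ext ⟨u, w, z⟩
      simp only [Finset.mem_filter, Finset.mem_singleton, Prod.mk.injEq]
      constructor
      · rintro ⟨h, rfl⟩
        exact ⟨((hC u w).mp h).1, ((hC u w).mp h).2, rfl⟩
      · rintro ⟨rfl, rfl, rfl⟩
        exact ⟨(hC u w).mpr ⟨rfl, rfl⟩, rfl⟩
    simp [this]
  · rw [if_neg (Ne.symm hvk), if_neg hvk]
    simp only [hC]
    by_cases hva : v = a
    · subst hva
      simp [hab.ne, Finset.filter_eq']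
    · by_cases hvb : v = b
      · subst hvb
        simp [hva, Finset.filter_eq']
      · simp [hva, hvb]

/-- Up to a sign the blocks of a row whose agent has exactly two in-neighbours do not depend on
the order of the agents. -/
theorem exists_sign_block {a b k : V}
    (hE : ∀ u, (u, k) ∈ F.graph.edges ↔ u = a ∨ u = b) (hab : a ≠ b) (hak : a ≠ k) (hbk : b ≠ k) :
    ∃ σ : ℝ, σ ≠ 0 ∧ ∀ v, F.block F.smallWeight k v = σ •
      if v = k then F.smallWeight a b else if v = a then F.smallWeight b k
      else if v = b then F.smallWeight k a else 0 := by
  rcases hab.lt_or_gt with h | h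
  · refine ⟨1, one_ne_zero, fun v => ?_⟩
    rw [F.block_of_two_neighbours _ hE h hak hbk, one_smul]
  · refine ⟨-1, by norm_num, fun v => ?_⟩
    rw [F.block_of_two_neighbours _ (fun u => (hE u).trans or_comm) h hbk hak]
    have h1 := F.smallWeight_swap a b
    have h2 := F.smallWeight_swap b k
    have h3 := F.smallWeight_swap k a
    split_ifs <;> simp_all

end Block

end NominalFormation

/-! ### Dual-entry paths in path order. -/

/-- The vertices of a dual-entry path in path order, from one entry agent to the other. -/
def pathVertex {V : Type*} (i j : V) {ℓ : ℕ} (q : Fin ℓ → V) (m : ℕ) : V :=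
  -- Every index beyond `ℓ` gives `j`, so injectivity holds only up to `ℓ + 1`.
  if m = 0 then i else if h : m - 1 < ℓ then q ⟨m - 1, h⟩ else j

section PathVertex

variable {V : Type*} (i j : V) {ℓ : ℕ} (q : Fin ℓ → V)

theorem pathVertex_zero : pathVertex i j q 0 = i := rfl

theorem pathVertex_inner (a : Fin ℓ) : pathVertex i j q (a + 1) = q a := by
  simp [pathVertex]

theorem pathVertex_last : pathVertex i j q (ℓ + 1) = j := by
  simp [pathVertex]

end PathVertex

namespace SensingGraph.IsDEP

variable {V : Type*} {G : SensingGraph V} {i j : V} {ℓ : ℕ} {q : Fin ℓ → V}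

theorem pathVertex_injOn (hG : G.IsDEP i j q) :
    Set.InjOn (pathVertex i j q) (Set.Iic (ℓ + 1)) := by
  intro m hm n hn h
  have hm' : m ≤ ℓ + 1 := hm
  have hn' : n ≤ ℓ + 1 := hn
  unfold pathVertex at h
  split_ifs at h with h1 h2 h3 h4 h5 h6 h7 h8
  · omega
  · exact absurd h.symm (hG.inner_ne_left _)
  · exact absurd h hG.entry_ne
  · exact absurd h (hG.inner_ne_left _)
  · have := congrArg Fin.val (hG.inner_injective h)
    simp only at this
    omega
  · exact absurd h (hG.inner_ne_right _)
  · exact absurd h.symm hG.entry_ne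
  · exact absurd h.symm (hG.inner_ne_right _)
  · omega

theorem pathVertex_eq_iff (hG : G.IsDEP i j q) {m n : ℕ} (hm : m ≤ ℓ + 1) (hn : n ≤ ℓ + 1) :
    pathVertex i j q m = pathVertex i j q n ↔ m = n :=
  hG.pathVertex_injOn.eq_iff hm hn

theorem mem_edges_inner (hG : G.IsDEP i j q) (a : Fin ℓ) (u : V) :
    (u, q a) ∈ G.edges ↔ u = pathVertex i j q a ∨ u = pathVertex i j q (a + 2) := by
  rw [hG.mem_edges]
  constructor
  · rintro (⟨b, hb, rfl, h⟩ | ⟨b, hb, rfl, h⟩ | ⟨b, c, hbc, ⟨rfl, h⟩ | ⟨rfl, h⟩⟩)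
    · rw [hG.inner_injective h, hb]
      exact Or.inl rfl
    · obtain rfl := hG.inner_injective h
      right
      rw [show a.val + 2 = ℓ + 1 by omega, pathVertex_last]
    · obtain rfl := hG.inner_injective h
      left
      rw [← hbc, pathVertex_inner]
    · obtain rfl := hG.inner_injective h
      right
      rw [show a.val + 2 = c.val + 1 by omega, pathVertex_inner]
  · rintro (rfl | rfl)
    · rcases Nat.eq_zero_or_pos a.val with h | h
      · exact Or.inl ⟨a, h, by rw [h, pathVertex_zero], rfl⟩
      · refine Or.inr (Or.inr ⟨⟨a - 1, by omega⟩, a, by simp only; omega, Or.inl ⟨?_, rfl⟩⟩)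
        rw [← pathVertex_inner i j q]
        congr 1
        simp only
        omega
    · by_cases h : a.val + 1 = ℓ
      · refine Or.inr (Or.inl ⟨a, h, ?_, rfl⟩)
        rw [show a.val + 2 = ℓ + 1 by omega, pathVertex_last]
      · refine Or.inr (Or.inr ⟨a, ⟨a + 1, by omega⟩, rfl, Or.inr ⟨?_, rfl⟩⟩)
        rw [← pathVertex_inner i j q]

/-- Entry agents measure nobody, so both ends of a two-way edge are inner agents. -/
theorem mem_edges_bidirectional (hG : G.IsDEP i j q) (u v : V) :
    ((u, v) ∈ G.edges ∧ (v, u) ∈ G.edges) ↔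
      ∃ k, 1 ≤ k ∧ k < ℓ ∧ ((u = pathVertex i j q k ∧ v = pathVertex i j q (k + 1)) ∨
        (v = pathVertex i j q k ∧ u = pathVertex i j q (k + 1))) := by
  constructor
  · rintro ⟨h1, h2⟩
    have hu : ∃ a, u = q a := by
      rcases (hG.mem_edges v u).mp h2 with ⟨a, -, -, h⟩ | ⟨a, -, -, h⟩ | ⟨a, b, -, ⟨-, h⟩ | ⟨-, h⟩⟩
      exacts [⟨a, h⟩, ⟨a, h⟩, ⟨b, h⟩, ⟨a, h⟩]
    obtain ⟨c, rfl⟩ := hu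
    rcases (hG.mem_edges _ v).mp h1 with ⟨a, -, h, -⟩ | ⟨a, -, h, -⟩ |
      ⟨a, b, hab, ⟨h, rfl⟩ | ⟨h, rfl⟩⟩
    · exact absurd h (hG.inner_ne_left _)
    · exact absurd h (hG.inner_ne_right _)
    · refine ⟨a + 1, by omega, by omega, Or.inl ⟨?_, ?_⟩⟩
      · rw [h, pathVertex_inner]
      · rw [hab, pathVertex_inner]
    · refine ⟨a + 1, by omega, by omega, Or.inr ⟨?_, ?_⟩⟩
      · rw [pathVertex_inner]
      · rw [h, hab, pathVertex_inner]
  · rintro ⟨k, hk, hkl, h⟩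
    have e1 : pathVertex i j q k = q ⟨k - 1, by omega⟩ := by
      rw [← pathVertex_inner i j q]
      congr 1
      simp only
      omega
    have e2 : pathVertex i j q (k + 1) = q ⟨k, hkl⟩ := by
      rw [← pathVertex_inner i j q]
    have key : (q ⟨k - 1, by omega⟩, q ⟨k, hkl⟩) ∈ G.edges ∧
        (q ⟨k, hkl⟩, q ⟨k - 1, by omega⟩) ∈ G.edges := by
      simp only [hG.mem_edges]
      exact ⟨Or.inr (Or.inr ⟨_, _, by simp only; omega, Or.inl ⟨rfl, rfl⟩⟩),
        Or.inr (Or.inr ⟨_, _, by simp only; omega, Or.inr ⟨rfl, rfl⟩⟩)⟩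
    rw [e1, e2] at h
    rcases h with ⟨rfl, rfl⟩ | ⟨rfl, rfl⟩
    · exact key
    · exact key.symm

end SensingGraph.IsDEP

/-! ### Reduction of the follower block to path matrices. -/

namespace NominalFormation

variable {V : Type*} (F : NominalFormation V) {i j : V} {ℓ : ℕ} {q : Fin ℓ → V}

/-- The projected coordinates along a dual-entry path. -/
noncomputable def pathCoord (i j : V) {ℓ : ℕ} (q : Fin ℓ → V) (c : Fin 3) (m : ℕ) : ℝ :=
  F.projState (pathVertex i j q m) c

theorem prod_diff_ne_zero_iff (u v : V) :
    F.diff u v 0 * F.diff u v 1 * F.diff u v 2 ≠ 0 ↔ ∀ c, F.diff u v c ≠ 0 := by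
  simp [Fin.forall_fin_succ, and_assoc]

theorem nondegenerate_iff [Fintype V] [LinearOrder V] (hF : F.graph.IsDEP i j q) :
    F.Nondegenerate i j ↔ ∀ c,
      (∀ k, 1 ≤ k → k < ℓ → F.pathCoord i j q c (k + 1) - F.pathCoord i j q c k ≠ 0) ∧
        F.pathCoord i j q c (ℓ + 1) - F.pathCoord i j q c 0 ≠ 0 := by
  have hpair : F.Nondegenerate i j ↔ ∀ u v,
      (((u, v) ∈ F.graph.edges ∧ (v, u) ∈ F.graph.edges) ∨ s(u, v) = s(i, j)) →
        ∀ c, F.diff u v c ≠ 0 := by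
    simp only [Nondegenerate, nondegeneracyPairs, Finset.prod_ne_zero_iff, prod_diff_ne_zero_iff,
      Finset.mem_filter, Finset.mem_univ, true_and, Prod.forall]
    constructor
    · intro h u v huv c
      have hne : u ≠ v := by
        rintro rfl
        rcases huv with huv | huv
        · exact F.graph.loopless u huv.1
        · exact hF.entry_ne (by aesop)
      rcases hne.lt_or_gt with hlt | hlt
      · exact h u v ⟨hlt, huv⟩ c
      · rw [← diff_swap_ne_zero]
        exact h v u ⟨hlt, huv.imp And.symm fun h => Sym2.eq_swap.trans h⟩ c
    · exact fun h u v huv => h u v huv.2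
  rw [hpair]
  constructor
  · refine fun h c => ⟨fun k hk hkl => ?_, ?_⟩
    · exact h _ _ (Or.inl ((hF.mem_edges_bidirectional _ _).mpr
        ⟨k, hk, hkl, Or.inr ⟨rfl, rfl⟩⟩)) c
    · have := h j i (Or.inr Sym2.eq_swap) c
      simpa [pathCoord, pathVertex_last, pathVertex_zero, diff] using this
  · rintro h u v (huv | huv) c
    · obtain ⟨k, hk, hkl, ⟨rfl, rfl⟩ | ⟨rfl, rfl⟩⟩ := (hF.mem_edges_bidirectional _ _).mp huv
      · exact F.diff_swap_ne_zero.mp ((h c).1 k hk hkl)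
      · exact (h c).1 k hk hkl
    · have hji : F.diff j i c ≠ 0 := by
        simpa [pathCoord, pathVertex_last, pathVertex_zero, diff] using (h c).2
      rcases Sym2.eq_iff.mp huv with ⟨rfl, rfl⟩ | ⟨rfl, rfl⟩
      · exact F.diff_swap_ne_zero.mp hji
      · exact hji

theorem stabilityCondition_pathCoord (hS : F.StabilityCondition i q) (c : Fin 3) (k : ℕ)
    (hk : 2 ≤ k) (hkl : k ≤ ℓ) : F.pathCoord i j q c k - F.pathCoord i j q c 0 ≠ 0 := by
  have h := Finset.prod_ne_zero_iff.mp hS ⟨k - 1, by omega⟩ (by simp; omega)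
  have h' := F.diff_swap_ne_zero.mpr ((F.prod_diff_ne_zero_iff _ _).mp h c)
  rw [← pathVertex_inner i j q] at h'
  simp only [Nat.sub_add_cancel (by omega : 1 ≤ k)] at h'
  exact h'

/-- The inner agents of a dual-entry path are the followers. -/
noncomputable def followerEquiv [DecidableEq V] {G : SensingGraph V} (hG : G.IsDEP i j q) :
    Fin ℓ ≃ {v : V // v ∉ ({i, j} : Finset V)} :=
  Equiv.ofBijective (fun a => ⟨q a, by simp [hG.inner_ne_left a, hG.inner_ne_right a]⟩) <| by
    constructor
    · intro a b h
      exact hG.inner_injective (congrArg Subtype.val h)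
    · rintro ⟨v, hv⟩
      simp only [Finset.mem_insert, Finset.mem_singleton, not_or] at hv
      rcases hG.vertices v with h | h | ⟨a, rfl⟩
      · exact absurd h hv.1
      · exact absurd h hv.2
      · exact ⟨a, rfl⟩

theorem exists_followerBlock_eq [Fintype V] [LinearOrder V] (hF : F.graph.IsDEP i j q) :
    ∃ σ : Fin ℓ → ℝ, (∀ a, σ a ≠ 0) ∧
      (F.followerBlock {i, j}).submatrix ((followerEquiv hF).prodCongr (Equiv.refl (Fin 3)))
        ((followerEquiv hF).prodCongr (Equiv.refl (Fin 3))) =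
      Matrix.blockDiagonal fun c =>
        Matrix.diagonal σ * pathMatrix ℓ (F.pathCoord i j q c) := by
  have hrow : ∀ a : Fin ℓ, ∃ σ : ℝ, σ ≠ 0 ∧ ∀ v, F.block F.smallWeight (q a) v = σ •
      if v = q a then F.smallWeight (pathVertex i j q a) (pathVertex i j q (a + 2))
      else if v = pathVertex i j q a then F.smallWeight (pathVertex i j q (a + 2)) (q a)
      else if v = pathVertex i j q (a + 2) then F.smallWeight (q a) (pathVertex i j q a)
      else 0 := by
    intro a
    refine F.exists_sign_block (hF.mem_edges_inner a) ?_ ?_ ?_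
    · rw [Ne, hF.pathVertex_eq_iff (by omega) (by omega)]
      omega
    · rw [← pathVertex_inner i j q, Ne, hF.pathVertex_eq_iff (by omega) (by omega)]
      omega
    · rw [← pathVertex_inner i j q, Ne, hF.pathVertex_eq_iff (by omega) (by omega)]
      omega
  choose σ hσ hblock using hrow
  refine ⟨σ, hσ, ?_⟩
  ext ⟨a, c⟩ ⟨b, d⟩
  change F.block F.smallWeight (q a) (q b) c d = _
  rw [hblock, Matrix.blockDiagonal_apply, Matrix.diagonal_mul]
  simp only [← pathVertex_inner i j q]
  simp only [hF.pathVertex_eq_iff (show b.val + 1 ≤ ℓ + 1 by omega)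
      (show a.val + 1 ≤ ℓ + 1 by omega),
    hF.pathVertex_eq_iff (show b.val + 1 ≤ ℓ + 1 by omega) (show a.val ≤ ℓ + 1 by omega),
    hF.pathVertex_eq_iff (show b.val + 1 ≤ ℓ + 1 by omega) (show a.val + 2 ≤ ℓ + 1 by omega)]
  have e1 : b.val + 1 = a.val + 1 ↔ b.val = a.val := by omega
  have e2 : b.val + 1 = a.val + 2 ↔ b.val = a.val + 1 := by omega
  simp only [e1, e2, pathMatrix, Matrix.of_apply, pathCoord, Matrix.smul_apply, smul_eq_mul]
  by_cases hcd : c = d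
  · subst hcd
    simp only [if_true]
    congr 1
    split_ifs <;> simp [smallWeight, diff]
  · rw [if_neg hcd]
    split_ifs <;> simp [smallWeight, hcd]

theorem isUnit_followerBlock_iff [Fintype V] [LinearOrder V] (hF : F.graph.IsDEP i j q) :
    IsUnit (F.followerBlock {i, j}) ↔ F.Nondegenerate i j := by
  obtain ⟨σ, hσ, hA⟩ := F.exists_followerBlock_eq hF
  rw [Matrix.isUnit_iff_isUnit_det, ← Matrix.det_submatrix_equiv_self
    ((followerEquiv hF).prodCongr (Equiv.refl (Fin 3))), hA, Matrix.det_blockDiagonal,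
    isUnit_iff_ne_zero, Finset.prod_ne_zero_iff, F.nondegenerate_iff hF]
  have hσ' : ∏ a, σ a ≠ 0 := Finset.prod_ne_zero_iff.mpr fun a _ => hσ a
  simp only [Finset.mem_univ, true_implies, Matrix.det_mul, Matrix.det_diagonal]
  refine forall_congr' fun c => ?_
  rw [← pathMatrix_det_ne_zero_iff ℓ hF.one_le]
  exact ⟨right_ne_zero_of_mul, mul_ne_zero hσ'⟩

theorem exists_stabilizing_followerBlock [Fintype V] [LinearOrder V] (hF : F.graph.IsDEP i j q)
    (hN : F.Nondegenerate i j) (hS : F.StabilityCondition i q) :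
    ∃ D : Matrix ({v : V // v ∉ ({i, j} : Finset V)} × Fin 3)
        ({v : V // v ∉ ({i, j} : Finset V)} × Fin 3) ℝ,
      D.IsDiag ∧ ∀ μ : ℂ, Module.End.HasEigenvalue
        (Matrix.toLin' ((D * F.followerBlock {i, j}).map (algebraMap ℝ ℂ))) μ → 0 < μ.re := by
  obtain ⟨σ, hσ, hA⟩ := F.exists_followerBlock_eq hF
  set e := (followerEquiv hF).prodCongr (Equiv.refl (Fin 3)) with he
  have hN' := (F.nondegenerate_iff hF).mp hN
  have hs : ∀ c k, 2 ≤ k → k ≤ ℓ + 1 →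
      F.pathCoord i j q c k - F.pathCoord i j q c 0 ≠ 0 := by
    intro c k hk hkl
    rcases Nat.lt_or_ge ℓ k with h | h
    · obtain rfl : k = ℓ + 1 := by omega
      exact (hN' c).2
    · exact F.stabilityCondition_pathCoord hS c k hk h
  -- The row signs are absorbed into the lower factor, whose diagonal need only be nonzero.
  set L : Matrix (Fin ℓ × Fin 3) (Fin ℓ × Fin 3) ℝ :=
    Matrix.blockDiagonal fun c => Matrix.diagonal σ * pathLower ℓ (F.pathCoord i j q c) with hL
  set U : Matrix (Fin ℓ × Fin 3) (Fin ℓ × Fin 3) ℝ :=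
    Matrix.blockDiagonal fun c => pathUpper ℓ (F.pathCoord i j q c) with hU
  have hLU : F.followerBlock {i, j} = L.submatrix e.symm e.symm * U.submatrix e.symm e.symm := by
    rw [Matrix.submatrix_mul_equiv, hL, hU, ← Matrix.blockDiagonal_mul]
    simp only [Matrix.mul_assoc]
    simp only [← pathMatrix_eq_mul ℓ (F.pathCoord i j q _) (hN' _).1 (hs _)]
    rw [← hA]
    simp
  rw [hLU]
  -- The rank is the position on the path; equal ranks in different coordinates are harmless, since
  -- the factors do not couple coordinates.
  refine Matrix.exists_isDiag_forall_eigenvalue_re_pos (fun v => (e.symm v).1.val) _ _ ?_ ?_ ?_ ?_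
  · intro k l h
    rw [← e.symm.injective.eq_iff]
    rw [Matrix.submatrix_apply] at h
    generalize e.symm k = k at h ⊢
    generalize e.symm l = l at h ⊢
    obtain ⟨a, c⟩ := k
    obtain ⟨b, d⟩ := l
    rw [hL, Matrix.blockDiagonal_apply, Matrix.diagonal_mul] at h
    simp only [pathLower, Matrix.of_apply] at h
    split_ifs at h with h1 h2 h3
    · exact Or.inl (Prod.ext h2.symm h1)
    · exact Or.inr (by simp only; omega)
    all_goals simp at h
  · intro k l h
    rw [← e.symm.injective.eq_iff]
    rw [Matrix.submatrix_apply] at h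
    generalize e.symm k = k at h ⊢
    generalize e.symm l = l at h ⊢
    obtain ⟨a, c⟩ := k
    obtain ⟨b, d⟩ := l
    rw [hU, Matrix.blockDiagonal_apply] at h
    simp only [pathUpper, Matrix.of_apply] at h
    split_ifs at h with h1 h2 h3
    · exact Or.inl (Prod.ext (Fin.ext h2.symm) h1)
    · exact Or.inr (by simp only; omega)
    all_goals simp at h
  · intro v
    rw [Matrix.submatrix_apply]
    generalize e.symm v = v
    obtain ⟨a, c⟩ := v
    rw [hL, Matrix.blockDiagonal_apply_eq, Matrix.diagonal_mul]
    simpa [pathLower] using hσ a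
  · intro v
    rw [Matrix.submatrix_apply]
    generalize e.symm v = v
    obtain ⟨a, c⟩ := v
    rw [hU, Matrix.blockDiagonal_apply_eq]
    simpa [pathUpper] using pathPivot_ne_zero ℓ _ (hN' c).1 (hs c) a a.2

end NominalFormation

theorem mainTheorem5 {V : Type*} [Fintype V] [LinearOrder V] (F : NominalFormation V)
    (i j : V) {ℓ : ℕ} (q : Fin ℓ → V) (hF : F.graph.IsDEP i j q) :
    (IsUnit (F.followerBlock {i, j}) ↔ F.Nondegenerate i j) ∧
    (F.Nondegenerate i j → F.StabilityCondition i q →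
      ∃ D : Matrix ({v : V // v ∉ ({i, j} : Finset V)} × Fin 3)
          ({v : V // v ∉ ({i, j} : Finset V)} × Fin 3) ℝ,
        D.IsDiag ∧
        ∀ μ : ℂ,
          Module.End.HasEigenvalue
            (Matrix.toLin' ((D * F.followerBlock {i, j}).map (algebraMap ℝ ℂ))) μ →
          0 < μ.re) := by
  exact ⟨F.isUnit_followerBlock_iff hF, F.exists_stabilizing_followerBlock hF⟩
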